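/- **Conventions.** For a semigroup $S$, let $S^1$ be $S$ with an identity adjoined, let $E(S)$ be its set of idempotents and let $\mathcal{L},\mathcal{R}$ be Green's relations. Write $a\,\mathcal{R}^*\,b$ if for all $x,y\in S^1$: $xa=ya\iff xb=yb$, and $a\,\mathcal{L}^*\,b$ if for all $x,y\in S^1$: $ax=ay\iff bx=by$. $S$ is *abundant* if each $\mathcal{R}^*$-class and each $\mathcal{L}^*$-class contains an idempotent. An abundant semigroup is *adequate* if its idempotents commute, *quasi-adequate* if its idempotents form a subsemigroup, *left adequate* (resp. *right adequate*) if each $\mathcal{R}^*$-class (resp. $\mathcal{L}^*$-class) contains a unique idempotent. In an adequate semigroup $a^+$ and $a^*$ denote the unique idempotents in the $\mathcal{R}^*$-class and in the $\mathcal{L}^*$-class of $a$. An abundant subsemigroup $U$ of an abundant semigroup $S$ is a *$*$-subsemigroup* if $\mathcal{R}^*(U)=\mathcal{R}^*(S)\cap(U\times U)$ and $\mathcal{L}^*(U)=\mathcal{L}^*(S)\cap(U\times U)$. An adequate $*$-subsemigroup $S^0$ of an abundant semigroup $S$ is an *adequate transversal* of $S$ if for each $x\in S$ there is a unique $\overline{x}\in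 S^0$ for which there exist $e,f\in E(S)$ with $x=e\overline{x}f$, $e\,\mathcal{L}\,\overline{x}^+$ and $f\,\mathcal{R}\,\overline{x}^*$. It is a *quasi-ideal* if $S^0SS^0\subseteq S^0$. An adequate transversal of a quasi-adequate semigroup is *admissible* if $\overline{xy}=\overline{x}\,\overline{y}$ for all $x,y\in S$. **Corollary.** Let $L$ be a left adequate semigroup and $R$ a right adequate semigroup with a common quasi-ideal adequate transversal $S^0$ (that is, quasi-ideal adequate transversals of $L$ and of $R$ which are identified by a fixed isomorphism). Then $$L|\!\times\!|R=\{(x,a)\in L\times R:\overline{x}=\overline{a}\}$$ is a semigroup under $$(x,a)(y,b)=(x\overline{y},\overline{a}b)=(x\overline{b},\overline{x}b),$$ it is quasi-adequate, and $\{(s,s):s\in S^0\}$, which is isomorphic to $S^0$ via $s\mapsto(s,s)$, is an admissible quasi-ideal adequate transversal of it. Conversely, let $S$ be a quasi-adequate semigroup with an admissible quasi-ideal adequate transversal $S^0$. Then there are a left adequate semigroup $L$ and a right adequate semigroup $R$ with a common quasi-ideal adequate transversal isomorphic to $S^0$, and an isomorphism $S\to L|\!\times\!|R$ that maps each $s\in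 S^0$ to $(s,s)$ (where $s$ is identified with its image in the common transversal). -/

import Mathlib

universe u v w

/-- Green's relation `𝓡`: `a S¹ = b S¹`. -/
def GreenR {S : Type*} [Semigroup S] (a b : S) : Prop :=
  (∃ u : WithOne S, (a : WithOne S) * u = b) ∧ (∃ v : WithOne S, (b : WithOne S) * v = a)

/-- Green's relation `𝓛`: `S¹ a = S¹ b`. -/
def GreenL {S : Type*} [Semigroup S] (a b : S) : Prop :=
  (∃ u : WithOne S, u * (a : WithOne S) = b) ∧ (∃ v : WithOne S, v * (b : WithOne S) = a)

/-- The relation `𝓡*`: for all `x, y ∈ S¹`, `x a = y a` if and only if `x b = y b`. -/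
def RStar {S : Type*} [Semigroup S] (a b : S) : Prop :=
  ∀ x y : WithOne S, x * (a : WithOne S) = y * a ↔ x * (b : WithOne S) = y * b

/-- The relation `𝓛*`: for all `x, y ∈ S¹`, `a x = a y` if and only if `b x = b y`. -/
def LStar {S : Type*} [Semigroup S] (a b : S) : Prop :=
  ∀ x y : WithOne S, (a : WithOne S) * x = a * y ↔ (b : WithOne S) * x = b * y

/-- Every `𝓡*`-class and every `𝓛*`-class contains an idempotent. -/
def IsAbundant (S : Type*) [Semigroup S] : Prop :=
  (∀ a : S, ∃ e : S, IsIdempotentElem e ∧ RStar a e) ∧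
    (∀ a : S, ∃ e : S, IsIdempotentElem e ∧ LStar a e)

/-- An abundant semigroup whose idempotents commute. -/
def IsAdequate (S : Type*) [Semigroup S] : Prop :=
  IsAbundant S ∧ ∀ e f : S, IsIdempotentElem e → IsIdempotentElem f → e * f = f * e

/-- An abundant semigroup whose idempotents form a subsemigroup. -/
def IsQuasiAdequate (S : Type*) [Semigroup S] : Prop :=
  IsAbundant S ∧ ∀ e f : S, IsIdempotentElem e → IsIdempotentElem f → IsIdempotentElem (e * f)

/-- An abundant semigroup in which every `𝓡*`-class contains a unique idempotent. -/
def IsLeftAdequate (S : Type*) [Semigroup S] : Prop :=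
  IsAbundant S ∧ ∀ a : S, ∃! e : S, IsIdempotentElem e ∧ RStar a e

/-- An abundant semigroup in which every `𝓛*`-class contains a unique idempotent. -/
def IsRightAdequate (S : Type*) [Semigroup S] : Prop :=
  IsAbundant S ∧ ∀ a : S, ∃! e : S, IsIdempotentElem e ∧ LStar a e

/-- `U` is a `*`-subsemigroup of `S`: it is abundant, and the relations `𝓡*` and `𝓛*` of `U` are
the restrictions to `U` of those of `S`. -/
def IsStarSubsemigroup {S : Type*} [Semigroup S] (U : Subsemigroup S) : Prop :=
  IsAbundant U ∧ (∀ a b : U, RStar a b ↔ RStar (a : S) (b : S)) ∧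
    (∀ a b : U, LStar a b ↔ LStar (a : S) (b : S))

/-- `x = e y f` for some idempotents `e`, `f` of `S` with `e 𝓛 y⁺` and `f 𝓡 y*`. Here `p = y⁺` and
`q = y*` are the idempotents of `U` in the `𝓡*`-class and in the `𝓛*`-class of `y` in `U`; they are
unique when `U` is adequate. -/
def IsBarOf {S : Type*} [Semigroup S] (U : Subsemigroup S) (x : S) (y : U) : Prop :=
  ∃ (e f : S) (p q : U), IsIdempotentElem e ∧ IsIdempotentElem f ∧
    IsIdempotentElem p ∧ RStar y p ∧ IsIdempotentElem q ∧ LStar y q ∧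
    x = e * (y : S) * f ∧ GreenL e (p : S) ∧ GreenR f (q : S)

/-- `U` is an adequate transversal of the abundant semigroup `S`: it is an adequate
`*`-subsemigroup, and each `x` in `S` has a unique `x̄` in `U` as in `IsBarOf`. -/
structure IsAdequateTransversal {S : Type*} [Semigroup S] (U : Subsemigroup S) : Prop where
  abundant : IsAbundant S
  adequate : IsAdequate U
  star : IsStarSubsemigroup U
  existsUnique_bar : ∀ x : S, ∃! y : U, IsBarOf U x y

/-- The element `x̄` of the adequate transversal `U`. -/
noncomputable def IsAdequateTransversal.bar {S : Type*} [Semigroup S] {U : Subsemigroup S}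
    (h : IsAdequateTransversal U) (x : S) : U :=
  (h.existsUnique_bar x).choose

/-- `U S U ⊆ U`. -/
def IsQuasiIdeal {S : Type*} [Semigroup S] (U : Subsemigroup S) : Prop :=
  ∀ a ∈ U, ∀ x : S, ∀ b ∈ U, a * x * b ∈ U

/-- The transversal is admissible: the bar of `x y` is the product of the bars of `x` and `y`. -/
def IsAdequateTransversal.IsAdmissible {S : Type*} [Semigroup S] {U : Subsemigroup S}
    (h : IsAdequateTransversal U) : Prop :=
  ∀ x y : S, h.bar (x * y) = h.bar x * h.bar y

theorem IsAdequateTransversal.bar_spec {S : Type*} [Semigroup S] {U : Subsemigroup S}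
    (h : IsAdequateTransversal U) (x : S) : IsBarOf U x (h.bar x) :=
  (h.existsUnique_bar x).choose_spec.1

theorem IsAdequateTransversal.bar_eq {S : Type*} [Semigroup S] {U : Subsemigroup S}
    (h : IsAdequateTransversal U) {x : S} {y : U} (hy : IsBarOf U x y) : h.bar x = y :=
  (h.existsUnique_bar x).unique (h.bar_spec x) hy

theorem GreenR.rStar {S : Type*} [Semigroup S] {a b : S} (h : GreenR a b) : RStar a b := by
  obtain ⟨⟨u, hu⟩, ⟨v, hv⟩⟩ := h
  intro x y
  constructor
  · intro hh
    rw [← hu, ← mul_assoc, ← mul_assoc, hh]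
  · intro hh
    rw [← hv, ← mul_assoc, ← mul_assoc, hh]

theorem GreenL.lStar {S : Type*} [Semigroup S] {a b : S} (h : GreenL a b) : LStar a b := by
  obtain ⟨⟨u, hu⟩, ⟨v, hv⟩⟩ := h
  intro x y
  constructor
  · intro hh
    rw [← hu, mul_assoc, mul_assoc, hh]
  · intro hh
    rw [← hv, mul_assoc, mul_assoc, hh]

theorem GreenR.mul_eq {S : Type*} [Semigroup S] {a e : S} (h : GreenR a e)
    (he : IsIdempotentElem e) : e * a = a := by
  obtain ⟨_, ⟨v, hv⟩⟩ := h
  apply WithOne.coe_injective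
  rw [WithOne.coe_mul, ← hv, ← mul_assoc, ← WithOne.coe_mul, he.eq]

theorem GreenL.mul_eq {S : Type*} [Semigroup S] {a e : S} (h : GreenL a e)
    (he : IsIdempotentElem e) : a * e = a := by
  obtain ⟨_, ⟨v, hv⟩⟩ := h
  apply WithOne.coe_injective
  rw [WithOne.coe_mul, ← hv, mul_assoc, ← WithOne.coe_mul, he.eq]

theorem GreenR.symm {S : Type*} [Semigroup S] {a b : S} (h : GreenR a b) : GreenR b a :=
  ⟨h.2, h.1⟩

theorem GreenL.symm {S : Type*} [Semigroup S] {a b : S} (h : GreenL a b) : GreenL b a :=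
  ⟨h.2, h.1⟩

theorem RStar.mul_eq {S : Type*} [Semigroup S] {a b c : S} (h : RStar a b) (hc : c * a = a) :
    c * b = b := by
  have := (h (c : WithOne S) 1).1 (by rw [one_mul, ← WithOne.coe_mul, hc])
  rw [one_mul, ← WithOne.coe_mul] at this
  exact WithOne.coe_injective this

theorem LStar.mul_eq {S : Type*} [Semigroup S] {a b c : S} (h : LStar a b) (hc : a * c = a) :
    b * c = b := by
  have := (h (c : WithOne S) 1).1 (by rw [mul_one, ← WithOne.coe_mul, hc])
  rw [mul_one, ← WithOne.coe_mul] at this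
  exact WithOne.coe_injective this

theorem RStar.symm {S : Type*} [Semigroup S] {a b : S} (h : RStar a b) : RStar b a :=
  fun x y => (h x y).symm

theorem LStar.symm {S : Type*} [Semigroup S] {a b : S} (h : LStar a b) : LStar b a :=
  fun x y => (h x y).symm

theorem IsAdequateTransversal.bar_mul_coe {L : Type*} [Semigroup L] {U : Subsemigroup L}
    (h : IsAdequateTransversal U) (hL : IsLeftAdequate L) (x : L) (s : U) :
    h.bar (x * s) = h.bar x * s := by
  apply h.bar_eq
  obtain ⟨e, f, p, q, he, hf, hp, hyp, hq, hyq, hx, hep, hfq⟩ := h.bar_spec x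
  generalize h.bar x = y at *
  obtain ⟨r, hr, hysr⟩ := h.adequate.1.1 (y * s)
  obtain ⟨t, ht, hyst⟩ := h.adequate.1.2 (y * s)
  have hqL : IsIdempotentElem (q : L) := congrArg Subtype.val hq
  have hpL : IsIdempotentElem (p : L) := congrArg Subtype.val hp
  have hrL : (r : L) * r = r := congrArg Subtype.val hr
  have hfq' : f = q := (hL.2 f).unique ⟨hf, fun _ _ => Iff.rfl⟩ ⟨hqL, hfq.rStar⟩
  have hyq' : y * q = y := hyq.symm.mul_eq hq
  have hpy : p * y = y := hyp.symm.mul_eq hp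
  have hpr : p * r = r := hysr.mul_eq (by rw [← mul_assoc, hpy])
  have hrp : r * p = r := by rw [h.adequate.2 r p hr hp, hpr]
  have hry : r * (y * s) = y * s := hysr.symm.mul_eq hr
  have hyt : y * s * t = y * s := hyst.symm.mul_eq ht
  have hpe : (p : L) * e = p := hep.symm.mul_eq he
  have hprL : (p : L) * r = r := congrArg Subtype.val hpr
  have hrpL : (r : L) * p = r := congrArg Subtype.val hrp
  have hryL : (r : L) * ((y : L) * s) = y * s := congrArg Subtype.val hry
  have hytL : (y : L) * s * t = y * s := congrArg Subtype.val hyt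
  have hyqL : (y : L) * q = y := congrArg Subtype.val hyq'
  have hrer : (r : L) * e * r = r := by
    calc (r : L) * e * r = r * p * e * r := by rw [hrpL]
      _ = r * (p * e) * r := by simp only [mul_assoc]
      _ = r := by rw [hpe, hrpL, hrL]
  refine ⟨e * r, t, r, t, ?_, congrArg Subtype.val ht, hr, hysr, ht, hyst, ?_, ?_, ?_⟩
  · calc e * r * (e * r) = e * (r * e * r) := by simp only [mul_assoc]
      _ = e * r := by rw [hrer]
  · calc x * s = e * ((y : L) * q) * s := by rw [hx, hfq', mul_assoc e]
      _ = e * (y * s) := by rw [hyqL, mul_assoc]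
      _ = e * (r * (y * s * t)) := by rw [hytL, hryL]
      _ = e * r * ((y * s : U) : L) * t := by
        simp only [mul_assoc, MulMemClass.coe_mul]
  · refine ⟨⟨(r : L), ?_⟩, ⟨(e : L), ?_⟩⟩
    · rw [← WithOne.coe_mul, ← mul_assoc, hrer]
    · rw [← WithOne.coe_mul]
  · exact ⟨⟨1, mul_one _⟩, ⟨1, mul_one _⟩⟩

theorem IsAdequateTransversal.bar_coe_mul {R : Type*} [Semigroup R] {U : Subsemigroup R}
    (h : IsAdequateTransversal U) (hR : IsRightAdequate R) (s : U) (x : R) :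
    h.bar (s * x) = s * h.bar x := by
  apply h.bar_eq
  obtain ⟨e, f, p, q, he, hf, hp, hyp, hq, hyq, hx, hep, hfq⟩ := h.bar_spec x
  generalize h.bar x = y at *
  obtain ⟨r, hr, hsyr⟩ := h.adequate.1.1 (s * y)
  obtain ⟨t, ht, hsyt⟩ := h.adequate.1.2 (s * y)
  have hpL : IsIdempotentElem (p : R) := congrArg Subtype.val hp
  have htL : (t : R) * t = t := congrArg Subtype.val ht
  have hep' : e = p := (hR.2 e).unique ⟨he, fun _ _ => Iff.rfl⟩ ⟨hpL, hep.lStar⟩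
  have hyq' : y * q = y := hyq.symm.mul_eq hq
  have hpy : p * y = y := hyp.symm.mul_eq hp
  have htq : t * q = t := hsyt.mul_eq (by rw [mul_assoc, hyq'])
  have hqt : q * t = t := by rw [h.adequate.2 q t hq ht, htq]
  have hry : r * (s * y) = s * y := hsyr.symm.mul_eq hr
  have hyt : s * y * t = s * y := hsyt.symm.mul_eq ht
  have hfq' : f * (q : R) = q := hfq.symm.mul_eq hf
  have hqtL : (q : R) * t = t := congrArg Subtype.val hqt
  have hryL : (r : R) * ((s : R) * y) = s * y := congrArg Subtype.val hry
  have hytL : (s : R) * y * t = s * y := congrArg Subtype.val hyt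
  have hpyL : (p : R) * y = y := congrArg Subtype.val hpy
  have htft : (t : R) * (f * t) = t := by
    calc (t : R) * (f * t) = t * (f * (q * t)) := by rw [hqtL]
      _ = t * (f * q * t) := by simp only [mul_assoc]
      _ = t := by rw [hfq', hqtL, htL]
  refine ⟨r, t * f, r, t, congrArg Subtype.val hr, ?_, hr, hsyr, ht, hsyt, ?_, ?_, ?_⟩
  · calc t * f * (t * f) = t * (f * t) * f := by simp only [mul_assoc]
      _ = t * f := by rw [htft]
  · calc s * x = s * ((p : R) * y) * f := by rw [hx, hep']; simp only [mul_assoc]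
      _ = s * y * f := by rw [hpyL]
      _ = r * (s * y * t) * f := by rw [hytL, hryL]
      _ = r * ((s * y : U) : R) * (t * f) := by
        simp only [mul_assoc, MulMemClass.coe_mul]
  · exact ⟨⟨1, one_mul _⟩, ⟨1, one_mul _⟩⟩
  · refine ⟨⟨(t : R), ?_⟩, ⟨(f : R), ?_⟩⟩
    · rw [← WithOne.coe_mul, mul_assoc, htft]
    · rw [← WithOne.coe_mul]

/-- A left adequate semigroup `L` and a right adequate semigroup `R` with a common quasi-ideal
adequate transversal: quasi-ideal adequate transversals of `L` and of `R`, identified by an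
isomorphism. -/
structure CommonTransversal (L R : Type*) [Semigroup L] [Semigroup R] where
  left : Subsemigroup L
  right : Subsemigroup R
  iso : left ≃* right
  leftAdequate : IsLeftAdequate L
  rightAdequate : IsRightAdequate R
  transversal_left : IsAdequateTransversal left
  transversal_right : IsAdequateTransversal right
  quasiIdeal_left : IsQuasiIdeal left
  quasiIdeal_right : IsQuasiIdeal right

/-- The spined product: the pairs `(x, a)` in `L × R` with `x̄ = ā`. -/
def CommonTransversal.SpinedProduct {L R : Type*} [Semigroup L] [Semigroup R]
    (D : CommonTransversal L R) : Type _ :=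
  {p : L × R // D.iso (D.transversal_left.bar p.1) = D.transversal_right.bar p.2}

/-- The multiplication `(x, a) (y, b) = (x ȳ, ā b)` of the spined product. -/
noncomputable instance CommonTransversal.instSemigroupSpinedProduct {L R : Type*} [Semigroup L]
    [Semigroup R] (D : CommonTransversal L R) : Semigroup D.SpinedProduct where
  mul p q := ⟨(p.1.1 * D.transversal_left.bar q.1.1, D.transversal_right.bar p.1.2 * q.1.2), by
    rw [D.transversal_left.bar_mul_coe D.leftAdequate,
      D.transversal_right.bar_coe_mul D.rightAdequate, map_mul, p.2, q.2]⟩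
  mul_assoc p q r := by
    apply Subtype.ext
    apply Prod.ext
    · change p.1.1 * (D.transversal_left.bar q.1.1 : L) * (D.transversal_left.bar r.1.1 : L) =
        p.1.1 * (D.transversal_left.bar (q.1.1 * (D.transversal_left.bar r.1.1 : L)) : L)
      rw [D.transversal_left.bar_mul_coe D.leftAdequate, mul_assoc, MulMemClass.coe_mul]
    · change (D.transversal_right.bar ((D.transversal_right.bar p.1.2 : R) * q.1.2) : R) * r.1.2 =
        (D.transversal_right.bar p.1.2 : R) * ((D.transversal_right.bar q.1.2 : R) * r.1.2)
      rw [D.transversal_right.bar_coe_mul D.rightAdequate, ← mul_assoc, MulMemClass.coe_mul]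

/-! The bar is a homomorphic retraction onto the transversal, and such a retraction forces
uniqueness. If `β : S → U` is one, idempotents of `U` commute, and `x = e y f` with `e 𝓛 y⁺` and `f
𝓡 y*`, then `β e` and `y⁺` are `𝓛`-related commuting idempotents, hence equal; likewise `β f = y*`,
so `β x = y⁺ y y* = y`. It remains to find one factorization over `β x` for each `x`, and this is
`IsAdequateTransversal.of_retraction`.

For the spined product, `x = e x̄` in a left adequate semigroup and `a = ā f` in a right adequate
one, so a pair is `(e s, s f)`. It factors through the diagonal with outer factors `(e, s⁺)` and
`(s*, f)`, and `β` is the common bar. A pair is idempotent exactly when its bar is, which gives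
quasi-adequacy.

For the converse, the key identity is `s x t = s x̄ t` for `s`, `t` in the transversal
(`IsAdmissible.coe_mul_mul_coe`). It makes the elements of the form `e s` and those of the form `s
f` into subsemigroups, to which the retraction criterion applies again, and `e s f ↦ (e s, s f)` is
the isomorphism. -/

/-! ### Starred relations and the retraction criterion. -/

theorem rStar_iff {S : Type*} [Semigroup S] {a b : S} :
    RStar a b ↔ (∀ x y : S, x * a = y * a ↔ x * b = y * b) ∧ ∀ x : S, x * a = a ↔ x * b = b := by
  constructor
  · intro h
    refine ⟨fun x y => ?_, fun x => ?_⟩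
    · simpa only [← WithOne.coe_mul, WithOne.coe_inj] using h x y
    · simpa only [← WithOne.coe_mul, WithOne.coe_inj, one_mul] using h x 1
  · rintro ⟨h₁, h₂⟩ x y
    induction x using WithOne.cases_on <;> induction y using WithOne.cases_on <;>
      simp only [← WithOne.coe_mul, WithOne.coe_inj, one_mul, h₁, h₂]
    · exact fun x => by rw [eq_comm, h₂, eq_comm]
    · exact fun _ => trivial
    · exact fun _ _ => trivial

theorem lStar_iff {S : Type*} [Semigroup S] {a b : S} :
    LStar a b ↔ (∀ x y : S, a * x = a * y ↔ b * x = b * y) ∧ ∀ x : S, a * x = a ↔ b * x = b := by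
  constructor
  · intro h
    refine ⟨fun x y => ?_, fun x => ?_⟩
    · simpa only [← WithOne.coe_mul, WithOne.coe_inj] using h x y
    · simpa only [← WithOne.coe_mul, WithOne.coe_inj, mul_one] using h x 1
  · rintro ⟨h₁, h₂⟩ x y
    induction x using WithOne.cases_on <;> induction y using WithOne.cases_on <;>
      simp only [← WithOne.coe_mul, WithOne.coe_inj, mul_one, h₁, h₂]
    · exact fun x => by rw [eq_comm, h₂, eq_comm]
    · exact fun _ => trivial
    · exact fun _ _ => trivial

theorem RStar.trans {S : Type*} [Semigroup S] {a b c : S} (h : RStar a b) (h' : RStar b c) :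
    RStar a c :=
  fun x y => (h x y).trans (h' x y)

theorem LStar.trans {S : Type*} [Semigroup S] {a b c : S} (h : LStar a b) (h' : LStar b c) :
    LStar a c :=
  fun x y => (h x y).trans (h' x y)

theorem RStar.mul_left {S : Type*} [Semigroup S] {a b : S} (h : RStar a b) (c : S) :
    RStar (c * a) (c * b) := fun x y => by
  simpa only [WithOne.coe_mul, ← mul_assoc] using h (x * c) (y * c)

theorem LStar.mul_right {S : Type*} [Semigroup S] {a b : S} (h : LStar a b) (c : S) :
    LStar (a * c) (b * c) := fun x y => by
  simpa only [WithOne.coe_mul, mul_assoc] using h (c * x) (c * y)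

theorem RStar.of_coe {S : Type*} [Semigroup S] {U : Subsemigroup S} {a b : U}
    (h : RStar (a : S) (b : S)) : RStar a b := by
  rw [rStar_iff] at h ⊢
  simp only [Subtype.ext_iff, MulMemClass.coe_mul]
  exact ⟨fun x y => h.1 x y, fun x => h.2 x⟩

theorem LStar.of_coe {S : Type*} [Semigroup S] {U : Subsemigroup S} {a b : U}
    (h : LStar (a : S) (b : S)) : LStar a b := by
  rw [lStar_iff] at h ⊢
  simp only [Subtype.ext_iff, MulMemClass.coe_mul]
  exact ⟨fun x y => h.1 x y, fun x => h.2 x⟩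

/-- As `e * a = a`, cancellation from `e` to `a` is automatic, and an adjoined identity acts on both
`a` and `e` as `e` does. So one implication over `S` itself is enough. -/
theorem RStar.of_idempotent {S : Type*} [Semigroup S] {a e : S} (he : e * e = e) (hea : e * a = a)
    (h : ∀ x y : S, x * a = y * a → x * e = y * e) : RStar a e := by
  rw [rStar_iff]
  refine ⟨fun x y => ⟨h x y, fun hxy => ?_⟩, fun x => ⟨fun hx => ?_, fun hx => ?_⟩⟩
  · rw [← hea, ← mul_assoc, hxy, mul_assoc]
  · rw [h x e (by rw [hx, hea]), he]
  · rw [← hea, ← mul_assoc, hx]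

theorem LStar.of_idempotent {S : Type*} [Semigroup S] {a e : S} (he : e * e = e) (hae : a * e = a)
    (h : ∀ x y : S, a * x = a * y → e * x = e * y) : LStar a e := by
  rw [lStar_iff]
  refine ⟨fun x y => ⟨h x y, fun hxy => ?_⟩, fun x => ⟨fun hx => ?_, fun hx => ?_⟩⟩
  · rw [← hae, mul_assoc, hxy, mul_assoc]
  · rw [h x e (by rw [hx, hae]), he]
  · rw [← hae, mul_assoc, hx]

theorem GreenR.of_mul_eq {S : Type*} [Semigroup S] {a b x y : S} (h : a * x = b) (h' : b * y = a) :
    GreenR a b :=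
  ⟨⟨x, by rw [← WithOne.coe_mul, h]⟩, ⟨y, by rw [← WithOne.coe_mul, h']⟩⟩

theorem GreenL.of_mul_eq {S : Type*} [Semigroup S] {a b x y : S} (h : x * a = b) (h' : y * b = a) :
    GreenL a b :=
  ⟨⟨x, by rw [← WithOne.coe_mul, h]⟩, ⟨y, by rw [← WithOne.coe_mul, h']⟩⟩

theorem IsBarOf.of_mul_eq {S : Type*} [Semigroup S] {U : Subsemigroup S} {x e f : S} {y p q : U}
    (hp : IsIdempotentElem p) (hq : IsIdempotentElem q) (hyp : RStar (y : S) p)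
    (hyq : LStar (y : S) q) (hx : x = e * y * f) (hep : e * p = e) (hpe : p * e = p)
    (hfq : f * q = q) (hqf : q * f = f) : IsBarOf U x y := by
  refine ⟨e, f, p, q, ?_, ?_, hp, .of_coe hyp, hq, .of_coe hyq, hx, .of_mul_eq hpe hep,
    .of_mul_eq hfq hqf⟩
  · calc e * e = e * p * e := by rw [hep]
      _ = e := by rw [mul_assoc, hpe, hep]
  · calc f * f = f * (q * f) := by rw [hqf]
      _ = f := by rw [← mul_assoc, hfq, hqf]

/-- Idempotents that are starred-related in `U` satisfy `f * e = e` and `e * f = f` (or the dual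
equations). Equations persist in `S`, so the relation does too. -/
theorem IsStarSubsemigroup.of_exists_idempotent {S : Type*} [Semigroup S] {U : Subsemigroup S}
    (hr : ∀ u : U, ∃ e : U, IsIdempotentElem e ∧ RStar (u : S) e)
    (hl : ∀ u : U, ∃ e : U, IsIdempotentElem e ∧ LStar (u : S) e) : IsStarSubsemigroup U := by
  refine ⟨⟨fun u => ?_, fun u => ?_⟩, fun a b => ⟨fun h => ?_, .of_coe⟩,
    fun a b => ⟨fun h => ?_, .of_coe⟩⟩
  · exact (hr u).imp fun e he => ⟨he.1, .of_coe he.2⟩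
  · exact (hl u).imp fun e he => ⟨he.1, .of_coe he.2⟩
  · obtain ⟨e, he, hae⟩ := hr a
    obtain ⟨f, hf, hbf⟩ := hr b
    have hef : RStar e f := ((RStar.of_coe hae).symm.trans h).trans (.of_coe hbf)
    refine (hae.trans (GreenR.rStar (.of_mul_eq (x := (f : S)) (y := (e : S)) ?_ ?_))).trans
      hbf.symm
    · exact congrArg Subtype.val (hef.mul_eq he)
    · exact congrArg Subtype.val (hef.symm.mul_eq hf)
  · obtain ⟨e, he, hae⟩ := hl a
    obtain ⟨f, hf, hbf⟩ := hl b
    have hef : LStar e f := ((LStar.of_coe hae).symm.trans h).trans (.of_coe hbf)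
    refine (hae.trans (GreenL.lStar (.of_mul_eq (x := (f : S)) (y := (e : S)) ?_ ?_))).trans
      hbf.symm
    · exact congrArg Subtype.val (hef.mul_eq he)
    · exact congrArg Subtype.val (hef.symm.mul_eq hf)

/-- If every element has a factorization as in `IsBarOf` over a `*`-subsemigroup, then the
semigroup is abundant. -/
theorem IsStarSubsemigroup.isAbundant {S : Type*} [Semigroup S] {U : Subsemigroup S}
    (hU : IsStarSubsemigroup U) (h : ∀ x : S, ∃ y : U, IsBarOf U x y) : IsAbundant S := by
  refine ⟨fun x => ?_, fun x => ?_⟩ <;>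
    obtain ⟨y, e, f, p, q, he, hf, hp, hyp, hq, hyq, rfl, hep, hfq⟩ := h x
  -- `y f 𝓡 y 𝓡* p`, and `𝓡*` is a left congruence, so `e y f 𝓡* e p = e`.
  · have hyfR : GreenR ((y : S) * f) y := by
      refine .of_mul_eq (x := (q : S)) (y := f) ?_ rfl
      rw [mul_assoc, hfq.symm.mul_eq hf]
      exact congrArg Subtype.val (hyq.symm.mul_eq hq)
    have := (hyfR.rStar.trans ((hU.2.1 _ _).1 hyp)).mul_left e
    rw [hep.mul_eq (congrArg Subtype.val hp), ← mul_assoc] at this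
    exact ⟨e, he, this⟩
  · have heyL : GreenL (e * (y : S)) y := by
      refine .of_mul_eq (x := (p : S)) (y := e) ?_ rfl
      rw [← mul_assoc, hep.symm.mul_eq he]
      exact congrArg Subtype.val (hyp.symm.mul_eq hp)
    have := (heyL.lStar.trans ((hU.2.2 _ _).1 hyq)).mul_right f
    rw [hfq.mul_eq (congrArg Subtype.val hq)] at this
    exact ⟨f, hf, this⟩

/-- A homomorphic retraction of `S` onto `U` that satisfies `IsBarOf` makes `U` an adequate
transversal. -/
theorem IsAdequateTransversal.of_retraction {S : Type*} [Semigroup S] {U : Subsemigroup S}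
    (β : S →ₙ* U) (hβ : ∀ u : U, β u = u)
    (hcomm : ∀ e f : U, IsIdempotentElem e → IsIdempotentElem f → e * f = f * e)
    (hr : ∀ u : U, ∃ e : U, IsIdempotentElem e ∧ RStar (u : S) e)
    (hl : ∀ u : U, ∃ e : U, IsIdempotentElem e ∧ LStar (u : S) e)
    (hbar : ∀ x : S, IsBarOf U x (β x)) : IsAdequateTransversal U := by
  have hstar := IsStarSubsemigroup.of_exists_idempotent hr hl
  refine ⟨hstar.isAbundant fun x => ⟨_, hbar x⟩, ⟨hstar.1, hcomm⟩, hstar,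
    fun x => ⟨β x, hbar x, ?_⟩⟩
  rintro y ⟨e, f, p, q, he, hf, hp, hyp, hq, hyq, rfl, hep, hfq⟩
  -- `β e` and `p` are `𝓛`-related idempotents of `U`; since they commute, they coincide.
  have hep' : β e = p := by
    have h₁ : β e * p = β e := by
      rw [← hβ p, ← map_mul, hep.mul_eq (congrArg Subtype.val hp)]
    have h₂ : p * β e = p := by
      conv_lhs => rw [← hβ p, ← map_mul, hep.symm.mul_eq he, hβ]
    rw [← h₁, hcomm _ _ (he.map β) hp, h₂]
  have hfq' : β f = q := by
    have h₁ : q * β f = β f := by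
      rw [← hβ q, ← map_mul, hfq.mul_eq (congrArg Subtype.val hq)]
    have h₂ : β f * q = q := by
      conv_lhs => rw [← hβ q, ← map_mul, hfq.symm.mul_eq hf, hβ]
    rw [← h₁, ← hcomm _ _ (hf.map β) hq, h₂]
  rw [map_mul, map_mul, hep', hfq', hβ, hyp.symm.mul_eq hp, hyq.symm.mul_eq hq]

/-! ### Chosen factorizations `x = e x̄ f`. -/

namespace IsAdequateTransversal

section Factorization

variable {S : Type*} [Semigroup S] {U : Subsemigroup S} (h : IsAdequateTransversal U)

/-- The idempotent `u⁺`. -/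
noncomputable def plus (u : U) : U := (h.adequate.1.1 u).choose

/-- The idempotent `u*`. -/
noncomputable def ast (u : U) : U := (h.adequate.1.2 u).choose

theorem isIdempotentElem_plus (u : U) : IsIdempotentElem (h.plus u) :=
  (h.adequate.1.1 u).choose_spec.1

theorem isIdempotentElem_ast (u : U) : IsIdempotentElem (h.ast u) :=
  (h.adequate.1.2 u).choose_spec.1

theorem rStar_plus (u : U) : RStar u (h.plus u) := (h.adequate.1.1 u).choose_spec.2

theorem lStar_ast (u : U) : LStar u (h.ast u) := (h.adequate.1.2 u).choose_spec.2

theorem rStar_coe_plus (u : U) : RStar (u : S) (h.plus u) := (h.star.2.1 _ _).1 (h.rStar_plus u)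

theorem lStar_coe_ast (u : U) : LStar (u : S) (h.ast u) := (h.star.2.2 _ _).1 (h.lStar_ast u)

theorem plus_mul (u : U) : h.plus u * u = u :=
  (h.rStar_plus u).symm.mul_eq (h.isIdempotentElem_plus u)

theorem mul_ast (u : U) : u * h.ast u = u :=
  (h.lStar_ast u).symm.mul_eq (h.isIdempotentElem_ast u)

theorem coe_plus_mul (u : U) : (h.plus u : S) * u = u := congrArg Subtype.val (h.plus_mul u)

theorem coe_mul_ast (u : U) : (u : S) * h.ast u = u := congrArg Subtype.val (h.mul_ast u)

theorem plus_eq {u p : U} (hp : IsIdempotentElem p) (hu : RStar u p) : h.plus u = p := by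
  have h₁ : p * h.plus u = h.plus u := (h.rStar_plus u).mul_eq (hu.symm.mul_eq hp)
  have h₂ : h.plus u * p = p := hu.mul_eq (h.plus_mul u)
  rw [← h₁, h.adequate.2 _ _ hp (h.isIdempotentElem_plus u), h₂]

theorem ast_eq {u q : U} (hq : IsIdempotentElem q) (hu : LStar u q) : h.ast u = q := by
  have h₁ : h.ast u * q = h.ast u := (h.lStar_ast u).mul_eq (hu.symm.mul_eq hq)
  have h₂ : q * h.ast u = q := hu.mul_eq (h.mul_ast u)
  rw [← h₁, h.adequate.2 _ _ (h.isIdempotentElem_ast u) hq, h₂]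

theorem exists_factors (x : S) : ∃ e f : S, x = e * (h.bar x : S) * f ∧
    (e * h.plus (h.bar x) = e ∧ h.plus (h.bar x) * e = h.plus (h.bar x)) ∧
    (f * h.ast (h.bar x) = h.ast (h.bar x) ∧ h.ast (h.bar x) * f = f) := by
  obtain ⟨e, f, p, q, he, hf, hp, hyp, hq, hyq, hx, hep, hfq⟩ := h.bar_spec x
  rw [h.plus_eq hp hyp, h.ast_eq hq hyq]
  exact ⟨e, f, hx, ⟨hep.mul_eq (congrArg Subtype.val hp), hep.symm.mul_eq he⟩,
    hfq.symm.mul_eq hf, hfq.mul_eq (congrArg Subtype.val hq)⟩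

/-- The idempotent `e` of a factorization `x = e x̄ f`. -/
noncomputable def leftFactor (x : S) : S := (h.exists_factors x).choose

/-- The idempotent `f` of a factorization `x = e x̄ f`. -/
noncomputable def rightFactor (x : S) : S := (h.exists_factors x).choose_spec.choose

theorem eq_factors (x : S) : x = h.leftFactor x * h.bar x * h.rightFactor x :=
  (h.exists_factors x).choose_spec.choose_spec.1

theorem leftFactor_mul_plus (x : S) : h.leftFactor x * h.plus (h.bar x) = h.leftFactor x :=
  (h.exists_factors x).choose_spec.choose_spec.2.1.1

theorem plus_mul_leftFactor (x : S) : h.plus (h.bar x) * h.leftFactor x = h.plus (h.bar x) :=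
  (h.exists_factors x).choose_spec.choose_spec.2.1.2

theorem rightFactor_mul_ast (x : S) : h.rightFactor x * h.ast (h.bar x) = h.ast (h.bar x) :=
  (h.exists_factors x).choose_spec.choose_spec.2.2.1

theorem ast_mul_rightFactor (x : S) : h.ast (h.bar x) * h.rightFactor x = h.rightFactor x :=
  (h.exists_factors x).choose_spec.choose_spec.2.2.2

theorem coe_isIdempotentElem_plus (u : U) : IsIdempotentElem (h.plus u : S) :=
  congrArg Subtype.val (h.isIdempotentElem_plus u)

theorem coe_isIdempotentElem_ast (u : U) : IsIdempotentElem (h.ast u : S) :=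
  congrArg Subtype.val (h.isIdempotentElem_ast u)

theorem bar_coe (u : U) : h.bar u = u :=
  h.bar_eq (.of_mul_eq (e := (h.plus u : S)) (f := (h.ast u : S)) (h.isIdempotentElem_plus u)
    (h.isIdempotentElem_ast u) (h.rStar_coe_plus u) (h.lStar_coe_ast u)
    (by rw [h.coe_plus_mul, h.coe_mul_ast]) (h.coe_isIdempotentElem_plus u)
    (h.coe_isIdempotentElem_plus u) (h.coe_isIdempotentElem_ast u) (h.coe_isIdempotentElem_ast u))

/-- `e = e x̄⁺ x̄⁺` is itself a factorization of the required kind, with middle term `x̄⁺`. -/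
theorem bar_leftFactor (x : S) : h.bar (h.leftFactor x) = h.plus (h.bar x) :=
  h.bar_eq (.of_mul_eq (e := h.leftFactor x) (f := (h.plus (h.bar x) : S))
    (h.isIdempotentElem_plus _) (h.isIdempotentElem_plus _) (fun _ _ => Iff.rfl)
    (fun _ _ => Iff.rfl) (by rw [h.leftFactor_mul_plus, h.leftFactor_mul_plus])
    (h.leftFactor_mul_plus x) (h.plus_mul_leftFactor x)
    (h.coe_isIdempotentElem_plus _) (h.coe_isIdempotentElem_plus _))

theorem bar_rightFactor (x : S) : h.bar (h.rightFactor x) = h.ast (h.bar x) :=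
  h.bar_eq (.of_mul_eq (e := (h.ast (h.bar x) : S)) (f := h.rightFactor x)
    (h.isIdempotentElem_ast _) (h.isIdempotentElem_ast _) (fun _ _ => Iff.rfl)
    (fun _ _ => Iff.rfl)
    (by rw [mul_assoc, h.ast_mul_rightFactor, h.ast_mul_rightFactor])
    (h.coe_isIdempotentElem_ast _) (h.coe_isIdempotentElem_ast _)
    (h.rightFactor_mul_ast x) (h.ast_mul_rightFactor x))

theorem isIdempotentElem_rightFactor (x : S) : IsIdempotentElem (h.rightFactor x) := by
  have := h.ast_mul_rightFactor x
  calc h.rightFactor x * h.rightFactor x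
      = h.rightFactor x * (h.ast (h.bar x) * h.rightFactor x) := by rw [this]
    _ = h.rightFactor x := by rw [← mul_assoc, h.rightFactor_mul_ast, this]

theorem isIdempotentElem_leftFactor (x : S) : IsIdempotentElem (h.leftFactor x) := by
  have := h.leftFactor_mul_plus x
  calc h.leftFactor x * h.leftFactor x
      = h.leftFactor x * h.plus (h.bar x) * h.leftFactor x := by rw [this]
    _ = h.leftFactor x := by rw [mul_assoc, h.plus_mul_leftFactor, this]

/-- The right factor and `x̄*` are `𝓡`-related idempotents, so left adequacy identifies them and the
right factor is absorbed by `x̄`. -/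
theorem leftFactor_mul_bar (hS : IsLeftAdequate S) (x : S) : h.leftFactor x * h.bar x = x := by
  have hf : h.rightFactor x = h.ast (h.bar x) :=
    (hS.2 (h.rightFactor x)).unique ⟨h.isIdempotentElem_rightFactor x, fun _ _ => Iff.rfl⟩
      ⟨h.coe_isIdempotentElem_ast _,
        (GreenR.of_mul_eq (h.rightFactor_mul_ast x) (h.ast_mul_rightFactor x)).rStar⟩
  conv_rhs => rw [h.eq_factors x, hf, mul_assoc, h.coe_mul_ast]

theorem bar_mul_rightFactor (hS : IsRightAdequate S) (x : S) : h.bar x * h.rightFactor x = x := by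
  have he : h.leftFactor x = h.plus (h.bar x) :=
    (hS.2 (h.leftFactor x)).unique ⟨h.isIdempotentElem_leftFactor x, fun _ _ => Iff.rfl⟩
      ⟨h.coe_isIdempotentElem_plus _,
        (GreenL.of_mul_eq (h.plus_mul_leftFactor x) (h.leftFactor_mul_plus x)).lStar⟩
  conv_rhs => rw [h.eq_factors x, he, h.coe_plus_mul]

end Factorization

end IsAdequateTransversal

/-! ### The spined product and its diagonal. -/

namespace CommonTransversal

variable {L R : Type*} [Semigroup L] [Semigroup R] (D : CommonTransversal L R)

/-- The map `(x, a) ↦ x̄ = ā`. -/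
noncomputable def barHom : D.SpinedProduct →ₙ* D.left where
  toFun p := D.transversal_left.bar p.1.1
  map_mul' p _ := D.transversal_left.bar_mul_coe D.leftAdequate p.1.1 _

theorem bar_fst (p : D.SpinedProduct) : D.transversal_left.bar p.1.1 = D.barHom p := rfl

theorem bar_snd (p : D.SpinedProduct) : D.transversal_right.bar p.1.2 = D.iso (D.barHom p) :=
  p.2.symm

theorem mul_fst (p q : D.SpinedProduct) : (p * q).1.1 = p.1.1 * (D.barHom q : L) := rfl

theorem mul_snd (p q : D.SpinedProduct) : (p * q).1.2 = (D.iso (D.barHom p) : R) * q.1.2 := by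
  rw [← bar_snd]; rfl

@[ext]
theorem SpinedProduct.ext {D : CommonTransversal L R} {p q : D.SpinedProduct}
    (h₁ : p.1.1 = q.1.1) (h₂ : p.1.2 = q.1.2) : p = q :=
  Subtype.ext (Prod.ext h₁ h₂)

/-- The map `s ↦ (s, s)`. -/
noncomputable def diagonal : D.left →ₙ* D.SpinedProduct where
  toFun s := ⟨(s, D.iso s), by
    rw [D.transversal_left.bar_coe, D.transversal_right.bar_coe]⟩
  map_mul' s t := by
    ext
    · change (s : L) * t = s * (D.transversal_left.bar (t : L) : L)
      rw [D.transversal_left.bar_coe]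
    · change (D.iso (s * t) : R) = D.transversal_right.bar (D.iso s : R) * D.iso t
      rw [D.transversal_right.bar_coe, map_mul, MulMemClass.coe_mul]

@[simp]
theorem diagonal_fst (s : D.left) : (D.diagonal s).1.1 = s := rfl

@[simp]
theorem diagonal_snd (s : D.left) : (D.diagonal s).1.2 = D.iso s := rfl

@[simp]
theorem barHom_diagonal (s : D.left) : D.barHom (D.diagonal s) = s := D.transversal_left.bar_coe s

/-- The isomorphism of the common transversal onto the diagonal. -/
noncomputable def diagonalEquiv : D.left ≃* D.diagonal.srange where
  toFun s := ⟨D.diagonal s, s, rfl⟩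
  invFun p := D.barHom p
  left_inv s := D.barHom_diagonal s
  right_inv := by
    rintro ⟨_, s, rfl⟩
    exact Subtype.ext (congrArg D.diagonal (D.barHom_diagonal s))
  map_mul' s t := Subtype.ext (map_mul D.diagonal s t)

@[simp]
theorem coe_diagonalEquiv (s : D.left) : (D.diagonalEquiv s : D.SpinedProduct) = D.diagonal s := rfl

/-- The retraction of the spined product onto the diagonal. -/
noncomputable def retraction : D.SpinedProduct →ₙ* D.diagonal.srange :=
  (D.diagonalEquiv : D.left →ₙ* D.diagonal.srange).comp D.barHom

theorem retraction_apply (p : D.SpinedProduct) : D.retraction p = D.diagonalEquiv (D.barHom p) :=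
  rfl

theorem retraction_coe (u : D.diagonal.srange) : D.retraction u = u := by
  rw [retraction_apply]
  exact D.diagonalEquiv.apply_symm_apply u

/-- The idempotent of the left transversal that corresponds to `s*` in the right one. -/
noncomputable def ast (s : D.left) : D.left := D.iso.symm (D.transversal_right.ast (D.iso s))

theorem iso_ast (s : D.left) : D.iso (D.ast s) = D.transversal_right.ast (D.iso s) :=
  D.iso.apply_symm_apply _

theorem isIdempotentElem_ast (s : D.left) : IsIdempotentElem (D.ast s) :=
  (D.transversal_right.isIdempotentElem_ast (D.iso s)).map D.iso.symm

theorem mul_ast (s : D.left) : s * D.ast s = s := by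
  apply D.iso.injective
  rw [map_mul, iso_ast, D.transversal_right.mul_ast]

/-- In the first coordinate, right multiplication by `(s, s)` is multiplication by `s` in `L`, where
`s 𝓡* s⁺` cancels. The second coordinate of such a product depends only on the bar of the left
factor, so applying the bar to the cancelled first coordinates settles it. -/
theorem rStar_diagonal (s : D.left) :
    RStar (D.diagonal s) (D.diagonal (D.transversal_left.plus s)) := by
  refine .of_idempotent ?_ ?_ fun y z hyz => ?_
  · rw [← map_mul, D.transversal_left.isIdempotentElem_plus s]
  · rw [← map_mul, D.transversal_left.plus_mul]
  · have h₁ := congrArg (fun p : D.SpinedProduct => p.1.1) hyz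
    simp only [mul_fst, barHom_diagonal] at h₁
    have h₂ := ((rStar_iff.1 (D.transversal_left.rStar_coe_plus s)).1 _ _).1 h₁
    have h₃ := congrArg D.transversal_left.bar h₂
    rw [D.transversal_left.bar_mul_coe D.leftAdequate,
      D.transversal_left.bar_mul_coe D.leftAdequate, bar_fst, bar_fst] at h₃
    ext
    · simpa only [mul_fst, barHom_diagonal] using h₂
    · simp only [mul_snd, diagonal_snd, ← MulMemClass.coe_mul, ← map_mul, h₃]

theorem lStar_diagonal (s : D.left) : LStar (D.diagonal s) (D.diagonal (D.ast s)) := by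
  refine .of_idempotent ?_ ?_ fun y z hyz => ?_
  · rw [← map_mul, D.isIdempotentElem_ast s]
  · rw [← map_mul, D.mul_ast]
  · have h₁ := congrArg (fun p : D.SpinedProduct => p.1.2) hyz
    simp only [mul_snd, barHom_diagonal] at h₁
    have h₂ := ((lStar_iff.1 (D.transversal_right.lStar_coe_ast (D.iso s))).1 _ _).1 h₁
    have h₃ := congrArg D.transversal_right.bar h₂
    rw [D.transversal_right.bar_coe_mul D.rightAdequate,
      D.transversal_right.bar_coe_mul D.rightAdequate, bar_snd, bar_snd, ← iso_ast, ← map_mul,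
      ← map_mul] at h₃
    ext
    · simp only [mul_fst, diagonal_fst, ← MulMemClass.coe_mul, D.iso.injective h₃]
    · simpa only [mul_snd, barHom_diagonal, iso_ast] using h₂

theorem isBarOf_retraction (p : D.SpinedProduct) :
    IsBarOf D.diagonal.srange p (D.retraction p) := by
  -- The left factor lives in `L` and the right factor in `R`; each is completed to a pair by its
  -- own bar, `x̄⁺` or `x̄*`.
  let e : D.SpinedProduct := ⟨(D.transversal_left.leftFactor p.1.1,
    D.iso (D.transversal_left.plus (D.barHom p))), by
      rw [D.transversal_left.bar_leftFactor, D.transversal_right.bar_coe]; rfl⟩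
  let f : D.SpinedProduct := ⟨(D.ast (D.barHom p), D.transversal_right.rightFactor p.1.2), by
      rw [D.transversal_right.bar_rightFactor, D.transversal_left.bar_coe, iso_ast, bar_snd]⟩
  have hbe : D.barHom e = D.transversal_left.plus (D.barHom p) :=
    D.transversal_left.bar_leftFactor _
  have hbf : D.barHom f = D.ast (D.barHom p) := D.transversal_left.bar_coe _
  refine .of_mul_eq (e := e) (f := f)
    (p := D.diagonalEquiv (D.transversal_left.plus (D.barHom p)))
    (q := D.diagonalEquiv (D.ast (D.barHom p)))
    ((D.transversal_left.isIdempotentElem_plus _).map D.diagonalEquiv)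
    ((D.isIdempotentElem_ast _).map D.diagonalEquiv) (D.rStar_diagonal _) (D.lStar_diagonal _)
    ?_ ?_ ?_ ?_ ?_ <;> ext <;>
    simp only [mul_fst, mul_snd, retraction_apply, coe_diagonalEquiv, map_mul, barHom_diagonal,
      hbe, hbf, diagonal_fst, diagonal_snd]
  · rw [mul_assoc, ← MulMemClass.coe_mul, mul_ast]
    exact (D.transversal_left.leftFactor_mul_bar D.leftAdequate p.1.1).symm
  · rw [← map_mul, D.transversal_left.plus_mul, ← bar_snd]
    exact (D.transversal_right.bar_mul_rightFactor D.rightAdequate p.1.2).symm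
  · exact D.transversal_left.leftFactor_mul_plus p.1.1
  · rw [← MulMemClass.coe_mul, ← map_mul, D.transversal_left.isIdempotentElem_plus]
  · rw [← MulMemClass.coe_mul, D.transversal_left.isIdempotentElem_plus]
  · rw [← MulMemClass.coe_mul, ← map_mul, D.transversal_left.isIdempotentElem_plus]
  · rw [← MulMemClass.coe_mul, D.isIdempotentElem_ast]
  · rw [← MulMemClass.coe_mul, ← map_mul, D.isIdempotentElem_ast]
  · rw [← MulMemClass.coe_mul, D.isIdempotentElem_ast]
  · rw [iso_ast, ← bar_snd]
    exact D.transversal_right.ast_mul_rightFactor p.1.2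

theorem isAdequateTransversal_diagonal : IsAdequateTransversal D.diagonal.srange := by
  refine .of_retraction D.retraction D.retraction_coe (fun e f he hf => ?_) (fun u => ?_)
    (fun u => ?_) D.isBarOf_retraction
  · apply D.diagonalEquiv.symm.injective
    rw [map_mul, map_mul]
    exact D.transversal_left.adequate.2 _ _ (he.map D.diagonalEquiv.symm)
      (hf.map D.diagonalEquiv.symm)
  · obtain ⟨s, rfl⟩ := D.diagonalEquiv.surjective u
    exact ⟨_, (D.transversal_left.isIdempotentElem_plus _).map D.diagonalEquiv,
      D.rStar_diagonal s⟩
  · obtain ⟨s, rfl⟩ := D.diagonalEquiv.surjective u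
    exact ⟨_, (D.isIdempotentElem_ast _).map D.diagonalEquiv, D.lStar_diagonal s⟩

theorem isAdmissible_diagonal : D.isAdequateTransversal_diagonal.IsAdmissible := by
  intro p q
  have hbar (r : D.SpinedProduct) : D.isAdequateTransversal_diagonal.bar r = D.retraction r :=
    D.isAdequateTransversal_diagonal.bar_eq (D.isBarOf_retraction r)
  rw [hbar, hbar, hbar, map_mul]

theorem isQuasiIdeal_diagonal : IsQuasiIdeal D.diagonal.srange := by
  rintro _ ⟨s, rfl⟩ p _ ⟨t, rfl⟩
  refine ⟨s * D.barHom p * t, ?_⟩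
  ext
  · simp only [mul_fst, barHom_diagonal, diagonal_fst, MulMemClass.coe_mul]
  · simp only [mul_snd, barHom_diagonal, diagonal_snd, MulMemClass.coe_mul, map_mul]

/-- The square of `(x, a)` is `(x x̄, ā a)`. With `x = e x̄` and `a = ā f`, idempotency of the bar
gives back `(x, a)`. -/
theorem isIdempotentElem_iff {p : D.SpinedProduct} :
    IsIdempotentElem p ↔ IsIdempotentElem (D.barHom p) := by
  refine ⟨fun hp => hp.map D.barHom, fun hp => ?_⟩
  have h₁ := D.transversal_left.leftFactor_mul_bar D.leftAdequate p.1.1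
  have h₂ := D.transversal_right.bar_mul_rightFactor D.rightAdequate p.1.2
  rw [bar_fst] at h₁
  rw [bar_snd] at h₂
  apply SpinedProduct.ext
  · rw [mul_fst]
    conv_lhs => rw [← h₁]
    rw [mul_assoc, ← MulMemClass.coe_mul, hp.eq, h₁]
  · rw [mul_snd]
    conv_lhs => rw [← h₂]
    rw [← mul_assoc, ← MulMemClass.coe_mul, ← map_mul, hp.eq, h₂]

theorem isQuasiAdequate : IsQuasiAdequate D.SpinedProduct := by
  refine ⟨D.isAdequateTransversal_diagonal.abundant, fun e f he hf => ?_⟩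
  rw [isIdempotentElem_iff, map_mul]
  have he := D.isIdempotentElem_iff.1 he
  have hf := D.isIdempotentElem_iff.1 hf
  exact he.mul_of_commute (D.transversal_left.adequate.2 _ _ he hf) hf

end CommonTransversal

/-! ### Admissible quasi-ideal transversals: the left and right parts. -/

namespace IsAdequateTransversal

section Admissible

variable {S : Type*} [Semigroup S] {U : Subsemigroup S} {h : IsAdequateTransversal U}

/-- By the quasi-ideal property `s x t` lies in `U`, so it equals its own bar, which is computed by
admissibility. -/
theorem IsAdmissible.coe_mul_mul_coe (hadm : h.IsAdmissible) (hU : IsQuasiIdeal U) (s t : U)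
    (x : S) : (s : S) * x * t = s * h.bar x * t := by
  have := h.bar_coe ⟨_, hU s s.2 x t t.2⟩
  rw [hadm, hadm, h.bar_coe, h.bar_coe] at this
  exact (congrArg Subtype.val this).symm

/-- This puts an element of `U` directly to the left of `x`, so that `IsAdmissible.coe_mul_mul_coe`
becomes applicable. -/
theorem leftFactor_mul_plus_mul (h : IsAdequateTransversal U) (x : S) :
    h.leftFactor x * (h.plus (h.bar x) * x) = x := by
  rw [← mul_assoc, h.leftFactor_mul_plus]
  nth_rw 2 3 [h.eq_factors x]
  rw [mul_assoc _ (h.bar x : S), ← mul_assoc, h.isIdempotentElem_leftFactor]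

theorem mul_ast_mul_rightFactor (h : IsAdequateTransversal U) (x : S) :
    x * h.ast (h.bar x) * h.rightFactor x = x := by
  rw [mul_assoc, h.ast_mul_rightFactor]
  nth_rw 1 3 [h.eq_factors x]
  rw [mul_assoc, h.isIdempotentElem_rightFactor]

theorem IsAdmissible.mul_coe (hadm : h.IsAdmissible) (hU : IsQuasiIdeal U) (x : S) (u : U) :
    x * u = h.leftFactor x * h.bar x * u := by
  conv_lhs => rw [← h.leftFactor_mul_plus_mul x]
  rw [mul_assoc, hadm.coe_mul_mul_coe hU, h.coe_plus_mul, mul_assoc]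

theorem IsAdmissible.coe_mul (hadm : h.IsAdmissible) (hU : IsQuasiIdeal U) (u : U) (x : S) :
    u * x = u * h.bar x * h.rightFactor x := by
  conv_lhs => rw [← h.mul_ast_mul_rightFactor x]
  rw [← mul_assoc, ← mul_assoc, hadm.coe_mul_mul_coe hU, mul_assoc (u : S), h.coe_mul_ast]

/-- The homomorphism `x ↦ x̄` of an admissible transversal. -/
noncomputable def IsAdmissible.barHom (hadm : h.IsAdmissible) : S →ₙ* U := ⟨h.bar, hadm⟩

theorem IsAdmissible.isIdempotentElem_bar (hadm : h.IsAdmissible) {x : S}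
    (hx : IsIdempotentElem x) : IsIdempotentElem (h.bar x) :=
  hx.map hadm.barHom

theorem plus_of_isIdempotentElem (h : IsAdequateTransversal U) {u : U} (hu : IsIdempotentElem u) :
    h.plus u = u :=
  h.plus_eq hu fun _ _ => Iff.rfl

theorem ast_of_isIdempotentElem (h : IsAdequateTransversal U) {u : U} (hu : IsIdempotentElem u) :
    h.ast u = u :=
  h.ast_eq hu fun _ _ => Iff.rfl

/-- The subsemigroup of the elements `e s` with `s ∈ U` and `e 𝓛 s⁺`. -/
noncomputable def leftPart (hadm : h.IsAdmissible) (hU : IsQuasiIdeal U) : Subsemigroup S where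
  carrier := {x | x * h.ast (h.bar x) = x}
  mul_mem' {x y} hx hy := by
    -- Once the product has the form `e u` with `u = x̄ ȳ` its bar, closure is just `u u* = u`.
    have hxy : x * y = h.leftFactor x * ((h.bar x * h.bar y : U) : S) := by
      conv_lhs => rw [← hx, ← hy, hadm.mul_coe hU x]
      rw [mul_assoc (h.leftFactor x), h.coe_mul_ast, mul_assoc, ← mul_assoc _ y,
        hadm.coe_mul_mul_coe hU, mul_assoc _ (h.bar y : S), h.coe_mul_ast, MulMemClass.coe_mul]
    change x * y * h.ast (h.bar (x * y)) = x * y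
    rw [hadm x y, hxy, mul_assoc, h.coe_mul_ast]

/-- The subsemigroup of the elements `s f` with `s ∈ U` and `f 𝓡 s*`. -/
noncomputable def rightPart (hadm : h.IsAdmissible) (hU : IsQuasiIdeal U) : Subsemigroup S where
  carrier := {x | h.plus (h.bar x) * x = x}
  mul_mem' {x y} hx hy := by
    have hxy : x * y = ((h.bar x * h.bar y : U) : S) * h.rightFactor y := by
      conv_lhs => rw [← hx, ← hy, hadm.coe_mul hU _ y]
      rw [h.coe_plus_mul, ← mul_assoc, hadm.coe_mul_mul_coe hU, h.coe_plus_mul,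
        MulMemClass.coe_mul]
    change h.plus (h.bar (x * y)) * (x * y) = x * y
    rw [hadm x y, hxy, ← mul_assoc, h.coe_plus_mul]

variable (hadm : h.IsAdmissible) (hU : IsQuasiIdeal U)

theorem mem_leftPart {x : S} : x ∈ leftPart hadm hU ↔ x * h.ast (h.bar x) = x := Iff.rfl

theorem mem_rightPart {x : S} : x ∈ rightPart hadm hU ↔ h.plus (h.bar x) * x = x := Iff.rfl

theorem le_leftPart : U ≤ leftPart hadm hU := fun u hu => by
  lift u to U using hu
  rw [mem_leftPart, h.bar_coe, h.coe_mul_ast]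

theorem le_rightPart : U ≤ rightPart hadm hU := fun u hu => by
  lift u to U using hu
  rw [mem_rightPart, h.bar_coe, h.coe_plus_mul]

/-! ### Restriction to subsemigroups containing the transversal. -/

/-- `U` as a subsemigroup of a larger subsemigroup. -/
def restrictEquiv {M : Subsemigroup S} (hM : U ≤ M) : U ≃* U.comap (MulMemClass.subtype M) where
  toFun u := ⟨⟨u, hM u.2⟩, u.2⟩
  invFun u := ⟨u.1, u.2⟩
  left_inv _ := rfl
  right_inv _ := rfl
  map_mul' _ _ := rfl

/-- The restriction of `x ↦ x̄` to a subsemigroup that contains the transversal. -/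
noncomputable def IsAdmissible.restrictBar {M : Subsemigroup S} (hM : U ≤ M) :
    M →ₙ* U.comap (MulMemClass.subtype M) :=
  ((restrictEquiv hM : U →ₙ* _).comp hadm.barHom).comp (MulMemClass.subtype M)

/-- `M` contains factors as in `IsBarOf` of each of its elements. -/
def HasFactors (h : IsAdequateTransversal U) (M : Subsemigroup S) : Prop :=
  ∀ x ∈ M, ∃ e ∈ M, ∃ f ∈ M, x = e * (h.bar x : S) * f ∧
    (e * h.plus (h.bar x) = e ∧ h.plus (h.bar x) * e = h.plus (h.bar x)) ∧
    (f * h.ast (h.bar x) = h.ast (h.bar x) ∧ h.ast (h.bar x) * f = f)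

theorem isBarOf_restrict {M : Subsemigroup S} (hM : U ≤ M) (hfac : HasFactors h M) (x : M) :
    IsBarOf (U.comap (MulMemClass.subtype M)) x (restrictEquiv hM (h.bar x)) := by
  obtain ⟨e, he, f, hf, hx, ⟨h₁, h₂⟩, h₃, h₄⟩ := hfac x x.2
  exact .of_mul_eq (e := ⟨e, he⟩) (f := ⟨f, hf⟩) (p := restrictEquiv hM (h.plus (h.bar x)))
    (q := restrictEquiv hM (h.ast (h.bar x)))
    ((h.isIdempotentElem_plus _).map (restrictEquiv hM))
    ((h.isIdempotentElem_ast _).map (restrictEquiv hM))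
    (.of_coe (h.rStar_coe_plus _)) (.of_coe (h.lStar_coe_ast _))
    (Subtype.ext hx) (Subtype.ext h₁) (Subtype.ext h₂) (Subtype.ext h₃) (Subtype.ext h₄)

include hadm in
-- The bar of `S` restricts to a homomorphic retraction of `M`, and `𝓡*`, `𝓛*` pass down to
-- subsemigroups; only the factors have to be found inside `M`.
theorem IsAdmissible.isAdequateTransversal_restrict {M : Subsemigroup S} (hM : U ≤ M)
    (hfac : HasFactors h M) : IsAdequateTransversal (U.comap (MulMemClass.subtype M)) := by
  refine .of_retraction (hadm.restrictBar hM) (fun u => ?_) (fun e f he hf => ?_) (fun u => ?_)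
    (fun u => ?_) (isBarOf_restrict hM hfac)
  · obtain ⟨s, rfl⟩ := (restrictEquiv hM).surjective u
    exact congrArg (restrictEquiv hM) (h.bar_coe s)
  · apply (restrictEquiv hM).symm.injective
    rw [map_mul, map_mul]
    exact h.adequate.2 _ _ (he.map (restrictEquiv hM).symm) (hf.map (restrictEquiv hM).symm)
  · obtain ⟨s, rfl⟩ := (restrictEquiv hM).surjective u
    exact ⟨restrictEquiv hM (h.plus s), (h.isIdempotentElem_plus _).map (restrictEquiv hM),
      .of_coe (h.rStar_coe_plus s)⟩
  · obtain ⟨s, rfl⟩ := (restrictEquiv hM).surjective u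
    exact ⟨restrictEquiv hM (h.ast s), (h.isIdempotentElem_ast _).map (restrictEquiv hM),
      .of_coe (h.lStar_coe_ast s)⟩

theorem isQuasiIdeal_restrict (hU : IsQuasiIdeal U) (M : Subsemigroup S) :
    IsQuasiIdeal (U.comap (MulMemClass.subtype M)) :=
  fun a ha x b hb => hU a ha x b hb

theorem hasFactors_leftPart : HasFactors h (leftPart hadm hU) := by
  intro x hx
  refine ⟨h.leftFactor x, ?_, h.ast (h.bar x), le_leftPart hadm hU (h.ast (h.bar x)).2, ?_,
    ⟨h.leftFactor_mul_plus x, h.plus_mul_leftFactor x⟩,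
    h.coe_isIdempotentElem_ast _, h.coe_isIdempotentElem_ast _⟩
  · rw [mem_leftPart, h.bar_leftFactor, h.ast_of_isIdempotentElem (h.isIdempotentElem_plus _),
      h.leftFactor_mul_plus]
  · rw [← hadm.mul_coe hU, hx]

theorem hasFactors_rightPart : HasFactors h (rightPart hadm hU) := by
  intro x hx
  refine ⟨h.plus (h.bar x), le_rightPart hadm hU (h.plus (h.bar x)).2, h.rightFactor x, ?_, ?_,
    ⟨h.coe_isIdempotentElem_plus _, h.coe_isIdempotentElem_plus _⟩,
    h.rightFactor_mul_ast x, h.ast_mul_rightFactor x⟩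
  · rw [mem_rightPart, h.bar_rightFactor, h.plus_of_isIdempotentElem (h.isIdempotentElem_ast _),
      h.ast_mul_rightFactor]
  · rw [← hadm.coe_mul hU, hx]

theorem isAdequateTransversal_leftPart :
    IsAdequateTransversal (U.comap (MulMemClass.subtype (leftPart hadm hU))) :=
  hadm.isAdequateTransversal_restrict (le_leftPart hadm hU) (hasFactors_leftPart hadm hU)

theorem isAdequateTransversal_rightPart :
    IsAdequateTransversal (U.comap (MulMemClass.subtype (rightPart hadm hU))) :=
  hadm.isAdequateTransversal_restrict (le_rightPart hadm hU) (hasFactors_rightPart hadm hU)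

theorem bar_leftPart (x : leftPart hadm hU) :
    (isAdequateTransversal_leftPart hadm hU).bar x =
      restrictEquiv (le_leftPart hadm hU) (h.bar x) :=
  bar_eq _ (isBarOf_restrict _ (hasFactors_leftPart hadm hU) x)

theorem bar_rightPart (x : rightPart hadm hU) :
    (isAdequateTransversal_rightPart hadm hU).bar x =
      restrictEquiv (le_rightPart hadm hU) (h.bar x) :=
  bar_eq _ (isBarOf_restrict _ (hasFactors_rightPart hadm hU) x)

include hadm in
-- The bars of `𝓡`-related idempotents are `𝓡`-related and commute, hence agree. Then `g = g ḡ = g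
-- k̄ = g k̄ k = g k = k`. This yields uniqueness of idempotents in the `𝓡*`-classes of the left
-- part.
theorem IsAdmissible.eq_of_mul_bar_eq {g k : S} (hg : IsIdempotentElem g)
    (hk : IsIdempotentElem k) (hgk : g * k = k) (hkg : k * g = g) (hgb : g * h.bar g = g)
    (hkb : (h.bar k : S) * k = h.bar k) : g = k := by
  have hb : h.bar g = h.bar k := by
    rw [← hgk, hadm, h.adequate.2 _ _ (hadm.isIdempotentElem_bar hg)
      (hadm.isIdempotentElem_bar hk), ← hadm, hkg]
  calc g = g * (h.bar k * k) := by rw [hkb, ← hb, hgb]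
    _ = k := by rw [← mul_assoc, ← hb, hgb, hgk]

include hadm in
theorem IsAdmissible.eq_of_bar_mul_eq {g k : S} (hg : IsIdempotentElem g)
    (hk : IsIdempotentElem k) (hgk : g * k = g) (hkg : k * g = k)
    (hgb : (h.bar g : S) * g = g) (hkb : k * h.bar k = h.bar k) : g = k := by
  have hb : h.bar g = h.bar k := by
    rw [← hgk, hadm, h.adequate.2 _ _ (hadm.isIdempotentElem_bar hg)
      (hadm.isIdempotentElem_bar hk), ← hadm, hkg]
  calc g = k * h.bar k * g := by rw [hkb, ← hb, hgb]
    _ = k := by rw [mul_assoc, ← hb, hgb, hkg]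

theorem mul_bar_of_mem_leftPart {g : S} (hg : IsIdempotentElem g) (hmem : g ∈ leftPart hadm hU) :
    g * h.bar g = g := by
  rwa [mem_leftPart, h.ast_of_isIdempotentElem (hadm.isIdempotentElem_bar hg)] at hmem

theorem bar_mul_of_mem_rightPart {g : S} (hg : IsIdempotentElem g)
    (hmem : g ∈ rightPart hadm hU) : (h.bar g : S) * g = g := by
  rwa [mem_rightPart, h.plus_of_isIdempotentElem (hadm.isIdempotentElem_bar hg)] at hmem

theorem bar_mul_of_mem_leftPart {g : S} (hg : IsIdempotentElem g) (hmem : g ∈ leftPart hadm hU) :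
    (h.bar g : S) * g = h.bar g := by
  have hb : (h.bar g : S) * h.bar g = h.bar g :=
    congrArg Subtype.val (hadm.isIdempotentElem_bar hg)
  nth_rw 2 [← mul_bar_of_mem_leftPart hadm hU hg hmem]
  rw [← mul_assoc, hadm.coe_mul_mul_coe hU, hb, hb]

theorem mul_bar_of_mem_rightPart {g : S} (hg : IsIdempotentElem g)
    (hmem : g ∈ rightPart hadm hU) : g * h.bar g = h.bar g := by
  have hb : (h.bar g : S) * h.bar g = h.bar g :=
    congrArg Subtype.val (hadm.isIdempotentElem_bar hg)
  nth_rw 1 [← bar_mul_of_mem_rightPart hadm hU hg hmem]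
  rw [hadm.coe_mul_mul_coe hU, hb, hb]

theorem isLeftAdequate_leftPart : IsLeftAdequate (leftPart hadm hU) := by
  refine ⟨(isAdequateTransversal_leftPart hadm hU).abundant, fun a => ?_⟩
  obtain ⟨g, hg, hag⟩ := (isAdequateTransversal_leftPart hadm hU).abundant.1 a
  refine ⟨g, ⟨hg, hag⟩, fun k ⟨hk, hak⟩ => Subtype.ext ?_⟩
  have hgk : RStar k g := hak.symm.trans hag
  have hg' : IsIdempotentElem (g : S) := congrArg Subtype.val hg
  have hk' : IsIdempotentElem (k : S) := congrArg Subtype.val hk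
  exact hadm.eq_of_mul_bar_eq hk' hg' (congrArg Subtype.val (hgk.mul_eq hk))
    (congrArg Subtype.val (hgk.symm.mul_eq hg)) (mul_bar_of_mem_leftPart hadm hU hk' k.2)
    (bar_mul_of_mem_leftPart hadm hU hg' g.2)

theorem isRightAdequate_rightPart : IsRightAdequate (rightPart hadm hU) := by
  refine ⟨(isAdequateTransversal_rightPart hadm hU).abundant, fun a => ?_⟩
  obtain ⟨g, hg, hag⟩ := (isAdequateTransversal_rightPart hadm hU).abundant.2 a
  refine ⟨g, ⟨hg, hag⟩, fun k ⟨hk, hak⟩ => Subtype.ext ?_⟩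
  have hgk : LStar k g := hak.symm.trans hag
  have hg' : IsIdempotentElem (g : S) := congrArg Subtype.val hg
  have hk' : IsIdempotentElem (k : S) := congrArg Subtype.val hk
  exact hadm.eq_of_bar_mul_eq hk' hg' (congrArg Subtype.val (hgk.symm.mul_eq hg))
    (congrArg Subtype.val (hgk.mul_eq hk)) (bar_mul_of_mem_rightPart hadm hU hk' k.2)
    (mul_bar_of_mem_rightPart hadm hU hg' g.2)

/-- The left part and the right part have the transversal in common. -/
noncomputable def commonTransversal :
    CommonTransversal (leftPart hadm hU) (rightPart hadm hU) where
  left := U.comap (MulMemClass.subtype _)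
  right := U.comap (MulMemClass.subtype _)
  iso := (restrictEquiv (le_leftPart hadm hU)).symm.trans (restrictEquiv (le_rightPart hadm hU))
  leftAdequate := isLeftAdequate_leftPart hadm hU
  rightAdequate := isRightAdequate_rightPart hadm hU
  transversal_left := isAdequateTransversal_leftPart hadm hU
  transversal_right := isAdequateTransversal_rightPart hadm hU
  quasiIdeal_left := isQuasiIdeal_restrict hU _
  quasiIdeal_right := isQuasiIdeal_restrict hU _

theorem commonTransversal_bar_eq_iff (x : leftPart hadm hU) (a : rightPart hadm hU) :
    (commonTransversal hadm hU).iso ((commonTransversal hadm hU).transversal_left.bar x) =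
      (commonTransversal hadm hU).transversal_right.bar a ↔ h.bar (x : S) = h.bar (a : S) := by
  have h₁ : (commonTransversal hadm hU).transversal_left.bar x = _ := bar_leftPart hadm hU x
  have h₂ : (commonTransversal hadm hU).transversal_right.bar a = _ := bar_rightPart hadm hU a
  rw [h₁, h₂]
  exact (restrictEquiv (le_rightPart hadm hU)).apply_eq_iff_eq

/-! ### The isomorphism onto the spined product. -/

include hadm in
theorem IsAdmissible.bar_mul_ast (x : S) : h.bar (x * h.ast (h.bar x)) = h.bar x := by
  rw [hadm, h.bar_coe, h.mul_ast]

include hadm in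
theorem IsAdmissible.bar_plus_mul (x : S) : h.bar (h.plus (h.bar x) * x) = h.bar x := by
  rw [hadm, h.bar_coe, h.plus_mul]

include hadm hU in
theorem IsAdmissible.mul_ast_bar (x : S) :
    x * h.ast (h.bar x) = h.leftFactor x * h.bar x := by
  rw [hadm.mul_coe hU, mul_assoc, h.coe_mul_ast]

include hadm hU in
theorem IsAdmissible.plus_bar_mul (x : S) :
    h.plus (h.bar x) * x = h.bar x * h.rightFactor x := by
  rw [hadm.coe_mul hU, h.coe_plus_mul]

/-- The map `x ↦ (x x̄*, x̄⁺ x)`, that is `e x̄ f ↦ (e x̄, x̄ f)`. -/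
noncomputable def toSpinedProduct (x : S) : (commonTransversal hadm hU).SpinedProduct :=
  ⟨(⟨x * h.ast (h.bar x), by
      rw [mem_leftPart, hadm.bar_mul_ast, mul_assoc, h.coe_isIdempotentElem_ast]⟩,
    ⟨h.plus (h.bar x) * x, by
      rw [mem_rightPart, hadm.bar_plus_mul, ← mul_assoc, h.coe_isIdempotentElem_plus]⟩), by
    rw [commonTransversal_bar_eq_iff]
    exact (hadm.bar_mul_ast x).trans (hadm.bar_plus_mul x).symm⟩

theorem toSpinedProduct_mul (x y : S) : toSpinedProduct hadm hU (x * y) =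
    toSpinedProduct hadm hU x * toSpinedProduct hadm hU y := by
  have h₁ := bar_leftPart hadm hU (toSpinedProduct hadm hU y).1.1
  have h₂ := bar_rightPart hadm hU (toSpinedProduct hadm hU x).1.2
  apply CommonTransversal.SpinedProduct.ext <;> apply Subtype.ext
  · refine Eq.trans ?_ (congrArg (fun t => x * h.ast (h.bar x) * ((t : leftPart hadm hU) : S))
      (congrArg Subtype.val h₁)).symm
    change x * y * h.ast (h.bar (x * y)) =
      x * h.ast (h.bar x) * (h.bar (y * h.ast (h.bar y)) : S)
    rw [hadm.bar_mul_ast, hadm.mul_ast_bar hU x]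
    -- Now `x y` stands between `x̄⁺` and the idempotent `(x y)*` of `U`, so it may be replaced by
    -- its bar `x̄ ȳ`.
    nth_rw 1 [← h.leftFactor_mul_plus_mul x]
    rw [mul_assoc, mul_assoc, mul_assoc, ← mul_assoc x, ← mul_assoc (h.plus (h.bar x) : S),
      hadm.coe_mul_mul_coe hU, mul_assoc, h.coe_mul_ast, hadm x y, MulMemClass.coe_mul,
      ← mul_assoc (h.plus (h.bar x) : S), h.coe_plus_mul, mul_assoc]
  · refine Eq.trans ?_ (congrArg (fun t => ((t : rightPart hadm hU) : S) *
      (h.plus (h.bar y) * y)) (congrArg Subtype.val h₂)).symm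
    change h.plus (h.bar (x * y)) * (x * y) =
      (h.bar (h.plus (h.bar x) * x) : S) * (h.plus (h.bar y) * y)
    rw [hadm.bar_plus_mul, hadm.plus_bar_mul hU y]
    nth_rw 2 [← h.mul_ast_mul_rightFactor y]
    rw [← mul_assoc, ← mul_assoc, ← mul_assoc, mul_assoc _ x y, hadm.coe_mul_mul_coe hU,
      h.coe_plus_mul, hadm x y, MulMemClass.coe_mul, mul_assoc (h.bar x : S), h.coe_mul_ast,
      mul_assoc]

theorem toSpinedProduct_injective : Function.Injective (toSpinedProduct hadm hU) := by
  intro x y hxy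
  have h₁ : x * h.ast (h.bar x) = y * h.ast (h.bar y) :=
    congrArg (fun p : (commonTransversal hadm hU).SpinedProduct => (p.1.1 : S)) hxy
  have h₂ : h.plus (h.bar x) * x = h.plus (h.bar y) * y :=
    congrArg (fun p : (commonTransversal hadm hU).SpinedProduct => (p.1.2 : S)) hxy
  have hb : h.bar x = h.bar y := by rw [← hadm.bar_mul_ast, h₁, hadm.bar_mul_ast]
  -- The two coordinates allow the left factor of `x` and then its right factor to be exchanged for
  -- those of `y`.
  calc x = h.leftFactor y * (h.bar y * h.rightFactor x) := by
        rw [← mul_assoc, ← hadm.mul_ast_bar hU, ← h₁, h.mul_ast_mul_rightFactor]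
    _ = y := by
        rw [← hb, ← hadm.plus_bar_mul hU, h₂, h.leftFactor_mul_plus_mul]

theorem toSpinedProduct_surjective : Function.Surjective (toSpinedProduct hadm hU) := by
  rintro ⟨⟨⟨x, hx⟩, ⟨a, ha⟩⟩, hxa⟩
  rw [commonTransversal_bar_eq_iff] at hxa
  change h.bar x = h.bar a at hxa
  rw [mem_leftPart] at hx
  rw [mem_rightPart] at ha
  have hb : h.bar (x * h.rightFactor a) = h.bar x := by
    rw [hadm, h.bar_rightFactor, ← hxa, h.mul_ast]
  -- With `x = e s` and `a = s f`, the preimage is `e s f`; its bar is `x̄ ā* = x̄`.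
  refine ⟨x * h.rightFactor a, ?_⟩
  apply CommonTransversal.SpinedProduct.ext <;> apply Subtype.ext
  · change x * h.rightFactor a * h.ast (h.bar (x * h.rightFactor a)) = x
    rw [hb, hxa, mul_assoc, h.rightFactor_mul_ast, ← hxa, hx]
  · change h.plus (h.bar (x * h.rightFactor a)) * (x * h.rightFactor a) = a
    rw [hb]
    nth_rw 2 [← hx]
    rw [← mul_assoc, ← mul_assoc, hadm.coe_mul_mul_coe hU, h.coe_plus_mul,
      h.coe_mul_ast, hxa, ← hadm.plus_bar_mul hU, ha]

/-- The isomorphism of `S` onto the spined product of its left part and its right part. -/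
noncomputable def spinedProductEquiv : S ≃* (commonTransversal hadm hU).SpinedProduct :=
  MulEquiv.ofBijective (⟨toSpinedProduct hadm hU, toSpinedProduct_mul hadm hU⟩ : S →ₙ* _)
    ⟨toSpinedProduct_injective hadm hU, toSpinedProduct_surjective hadm hU⟩

end Admissible

end IsAdequateTransversal

theorem mainTheorem5 :
    (∀ (L : Type u) (R : Type v) [Semigroup L] [Semigroup R] (D : CommonTransversal L R),
      (∀ p q : D.SpinedProduct,
        (p * q).1 = (p.1.1 * (D.transversal_left.bar q.1.1 : L),
          (D.transversal_right.bar p.1.2 : R) * q.1.2) ∧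
        (p * q).1 = (p.1.1 * (D.iso.symm (D.transversal_right.bar q.1.2) : L),
          (D.iso (D.transversal_left.bar p.1.1) : R) * q.1.2)) ∧
      IsQuasiAdequate D.SpinedProduct ∧
        ∃ (T : Subsemigroup D.SpinedProduct) (hT : IsAdequateTransversal T) (θ : D.left ≃* T),
          IsQuasiIdeal T ∧ hT.IsAdmissible ∧
            ∀ s : D.left, (θ s : D.SpinedProduct).1 = ((s : L), (D.iso s : R))) ∧
    (∀ (S : Type w) [Semigroup S] (S₀ : Subsemigroup S) (h : IsAdequateTransversal S₀),
      IsQuasiAdequate S → IsQuasiIdeal S₀ → h.IsAdmissible →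
        ∃ (L : Type w) (R : Type w) (_ : Semigroup L) (_ : Semigroup R)
          (D : CommonTransversal L R) (Ψ : S ≃* D.SpinedProduct) (ψ : S₀ ≃* D.left),
          ∀ s : S₀, (Ψ (s : S)).1 = ((ψ s : L), (D.iso (ψ s) : R))) := by
  refine ⟨fun L R _ _ D => ⟨fun p q => ⟨rfl, ?_⟩, D.isQuasiAdequate, D.diagonal.srange,
    D.isAdequateTransversal_diagonal, D.diagonalEquiv, D.isQuasiIdeal_diagonal,
    D.isAdmissible_diagonal, fun _ => rfl⟩, fun S _ S₀ h _ hU hadm => ?_⟩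
  · rw [D.bar_snd, MulEquiv.symm_apply_apply, D.bar_fst, ← D.bar_snd]
    rfl
  · refine ⟨_, _, _, _, IsAdequateTransversal.commonTransversal hadm hU,
      IsAdequateTransversal.spinedProductEquiv hadm hU,
      IsAdequateTransversal.restrictEquiv (IsAdequateTransversal.le_leftPart hadm hU), fun s => ?_⟩
    refine Prod.ext (Subtype.ext ?_) (Subtype.ext ?_)
    · change (s : S) * h.ast (h.bar s) = s
      rw [h.bar_coe, h.coe_mul_ast]
    · change h.plus (h.bar s) * (s : S) = s
      rw [h.bar_coe, h.coe_plus_mul]
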